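/- Let $H$ be a complex Hilbert space. A conjugation on $H$ is a conjugate-linear map $C:H\to H$ with $C^2=I$ and $\langle Cx, Cy\rangle=\langle y, x\rangle$ for all $x,y\in H$. For integers $n\ge 0$, $m\ge 1$ and a conjugation $C$ on $H$, a bounded linear operator $T$ on $H$ is called $n$-quasi-$(m,C)$-isometric if $$T^{*n}\Big(\sum_{j=0}^{m}(-1)^j\binom{m}{j}\,T^{*(m-j)}\,C\,T^{m-j}\,C\Big)T^{n}=0 .$$ Let $H\overline{\otimes}H$ be the Hilbert tensor product, i.e. the completion of the algebraic tensor product $H\otimes H$ for the inner product determined by $\langle x\otimes y, u\otimes v\rangle=\langle x,u\rangle\langle y,v\rangle$. For bounded linear operators $T,S$ on $H$, let $T\otimes S$ be the bounded linear operator on $H\overline{\otimes}H$ with $(T\otimes S)(x\otimes y)=Tx\otimes Sy$; for conjugations $C,D$ on $H$, let $C\otimes D$ be the conjugation on $H\overline{\otimes}H$ with $(C\otimes D)(x\otimes y)=Cx\otimes Dy$. **Theorem.** Let $n_1,n_2\ge 0$ and $m,k\ge 1$ be integers, let $C,D$ be conjugations on $H$, and let $T,S$ be bounded linear operators on $H$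 such that $T$ is $n_1$-quasi-$(m,C)$-isometric and $S$ is $n_2$-quasi-$(k,D)$-isometric. If $T(CTC)=(CTC)T$ and $S(DSD)=(DSD)S$, then $T\otimes S$ is a $\max\{n_1,n_2\}$-quasi-$(m+k-1,\,C\otimes D)$-isometric operator on $H\overline{\otimes}H$. -/

import Mathlib

open scoped TensorProduct ComplexConjugate

noncomputable section

/-- A conjugation on a complex inner product space: a conjugate-linear map `C` that is involutive
(`C² = I`) and isometric (`⟪C x, C y⟫ = ⟪y, x⟫`). -/
structure Conjugation (H : Type*) [NormedAddCommGroup H] [InnerProductSpace ℂ H] where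
  toLinearMap : H →ₗ⋆[ℂ] H
  involutive : ∀ x, toLinearMap (toLinearMap x) = x
  isometric : ∀ x y, inner ℂ (toLinearMap x) (toLinearMap y) = inner ℂ y x

namespace Conjugation

variable {H K : Type*} [NormedAddCommGroup H] [InnerProductSpace ℂ H]
  [NormedAddCommGroup K] [InnerProductSpace ℂ K]

theorem norm_apply (C : Conjugation H) (x : H) : ‖C.toLinearMap x‖ = ‖x‖ := by
  rw [@norm_eq_sqrt_re_inner ℂ, @norm_eq_sqrt_re_inner ℂ _ _ _ _ x, C.isometric]

/-- A conjugation as a bounded conjugate-linear operator. -/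
def toCLM (C : Conjugation H) : H →L⋆[ℂ] H :=
  C.toLinearMap.mkContinuous 1 fun x => by rw [C.norm_apply, one_mul]

@[simp] theorem toCLM_apply (C : Conjugation H) (x : H) : C.toCLM x = C.toLinearMap x := rfl

/-- The bounded linear operator `C T C`. -/
def sandwich (C : Conjugation H) (T : H →L[ℂ] H) : H →L[ℂ] H :=
  C.toCLM.comp (T.comp C.toCLM)

theorem sandwich_apply (C : Conjugation H) (T : H →L[ℂ] H) (x : H) :
    C.sandwich T x = C.toLinearMap (T (C.toLinearMap x)) := rfl

end Conjugation

/-- The Hilbert tensor product: the completion of the algebraic tensor product for the inner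
product `⟪x ⊗ y, u ⊗ v⟫ = ⟪x, u⟫ ⟪y, v⟫`. -/
abbrev HilbertTensor (H K : Type*) [NormedAddCommGroup H] [InnerProductSpace ℂ H]
    [NormedAddCommGroup K] [InnerProductSpace ℂ K] : Type _ :=
  UniformSpace.Completion (H ⊗[ℂ] K)

namespace HilbertTensor

variable {H K : Type*} [NormedAddCommGroup H] [InnerProductSpace ℂ H]
  [NormedAddCommGroup K] [InnerProductSpace ℂ K]

/-- Extension by continuity to the completion of a bounded (conjugate-)linear map on the algebraic
tensor product. -/
def extend {σ : ℂ →+* ℂ} (f : H ⊗[ℂ] K →SL[σ] HilbertTensor H K) :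
    HilbertTensor H K →SL[σ] HilbertTensor H K :=
  f.extend (UniformSpace.Completion.toComplL (𝕜 := ℂ))

theorem extend_coe {σ : ℂ →+* ℂ} (f : H ⊗[ℂ] K →SL[σ] HilbertTensor H K) (x : H ⊗[ℂ] K) :
    extend f (x : HilbertTensor H K) = f x :=
  f.extend_eq (e := UniformSpace.Completion.toComplL (𝕜 := ℂ))
    UniformSpace.Completion.denseRange_coe
    (UniformSpace.Completion.isUniformInducing_coe _) x

/-- The operator `T ⊗ S` on the Hilbert tensor product. -/
def map (T : H →L[ℂ] H) (S : K →L[ℂ] K) : HilbertTensor H K →L[ℂ] HilbertTensor H K :=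
  extend (UniformSpace.Completion.toComplL.comp (TensorProduct.mapL T S))

theorem map_coe (T : H →L[ℂ] H) (S : K →L[ℂ] K) (x : H ⊗[ℂ] K) :
    map T S (x : HilbertTensor H K) = (TensorProduct.mapL T S x : H ⊗[ℂ] K) :=
  extend_coe _ x

theorem map_tmul (T : H →L[ℂ] H) (S : K →L[ℂ] K) (x : H) (y : K) :
    map T S ((x ⊗ₜ[ℂ] y : H ⊗[ℂ] K) : HilbertTensor H K) = (T x ⊗ₜ[ℂ] S y : H ⊗[ℂ] K) :=
  map_coe T S _

end HilbertTensor

namespace Conjugation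

variable {H K : Type*} [NormedAddCommGroup H] [InnerProductSpace ℂ H]
  [NormedAddCommGroup K] [InnerProductSpace ℂ K]

/-- The conjugation `x ⊗ y ↦ C x ⊗ D y` on the algebraic tensor product. -/
def algTensor (C : Conjugation H) (D : Conjugation K) : Conjugation (H ⊗[ℂ] K) where
  toLinearMap := TensorProduct.map C.toLinearMap D.toLinearMap
  involutive x := by
    induction x using TensorProduct.induction_on with
    | zero => simp
    | tmul a b => simp [C.involutive, D.involutive]
    | add a b ha hb => simp [ha, hb]
  isometric x y := by
    induction x using TensorProduct.induction_on with
    | zero => simp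
    | tmul a b =>
      induction y using TensorProduct.induction_on with
      | zero => simp
      | tmul c d => simp [C.isometric, D.isometric]
      | add c d hc hd => rw [map_add, inner_add_right, hc, hd, inner_add_left]
    | add a b ha hb => rw [map_add, inner_add_left, ha, hb, inner_add_right]

/-- The extension of `algTensor C D` by continuity to the Hilbert tensor product. -/
def tensorCLM (C : Conjugation H) (D : Conjugation K) :
    HilbertTensor H K →L⋆[ℂ] HilbertTensor H K :=
  HilbertTensor.extend (UniformSpace.Completion.toComplL.comp (C.algTensor D).toCLM)

theorem tensorCLM_coe (C : Conjugation H) (D : Conjugation K) (x : H ⊗[ℂ] K) :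
    C.tensorCLM D (x : HilbertTensor H K) = ((C.algTensor D).toLinearMap x : H ⊗[ℂ] K) :=
  HilbertTensor.extend_coe _ x

/-- The conjugation `C ⊗ D` on the Hilbert tensor product. -/
def tensor (C : Conjugation H) (D : Conjugation K) : Conjugation (HilbertTensor H K) where
  toLinearMap := (C.tensorCLM D).toLinearMap
  involutive x := by
    induction x using UniformSpace.Completion.induction_on with
    | hp => exact isClosed_eq (by simp only [ContinuousLinearMap.coe_coe]; fun_prop) continuous_id
    | ih a => simp only [ContinuousLinearMap.coe_coe, tensorCLM_coe, (C.algTensor D).involutive]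
  isometric x y := by
    induction x, y using UniformSpace.Completion.induction_on₂ with
    | hp =>
      simp only [ContinuousLinearMap.coe_coe]
      exact isClosed_eq (by fun_prop) (by fun_prop)
    | ih a b =>
      simp only [ContinuousLinearMap.coe_coe, tensorCLM_coe, UniformSpace.Completion.inner_coe,
        (C.algTensor D).isometric]

theorem tensor_tmul (C : Conjugation H) (D : Conjugation K) (x : H) (y : K) :
    (C.tensor D).toLinearMap ((x ⊗ₜ[ℂ] y : H ⊗[ℂ] K) : HilbertTensor H K) =
      (C.toLinearMap x ⊗ₜ[ℂ] D.toLinearMap y : H ⊗[ℂ] K) :=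
  tensorCLM_coe C D _

end Conjugation

/-- `Λ_m(T) = ∑_{0 ≤ j ≤ m} (-1)^j (m choose j) T*^(m-j) C T^(m-j) C`. -/
def cIsometryDefect {H : Type*} [NormedAddCommGroup H] [InnerProductSpace ℂ H] [CompleteSpace H]
    (m : ℕ) (C : Conjugation H) (T : H →L[ℂ] H) : H →L[ℂ] H :=
  ∑ j ∈ Finset.range (m + 1),
    ((-1 : ℂ) ^ j * (m.choose j : ℂ)) •
      ((ContinuousLinearMap.adjoint T) ^ (m - j) * C.sandwich (T ^ (m - j)))

/-- `T` is `n`-quasi-`(m, C)`-isometric: `T*^n Λ_m(T) T^n = 0`. -/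
def IsQuasiCIsometric {H : Type*} [NormedAddCommGroup H] [InnerProductSpace ℂ H] [CompleteSpace H]
    (n m : ℕ) (C : Conjugation H) (T : H →L[ℂ] H) : Prop :=
  (ContinuousLinearMap.adjoint T) ^ n * cIsometryDefect m C T * T ^ n = 0

end

/-!
For a bounded operator `T` and a conjugation `C`, let `Φ` be the linear endomorphism
`X ↦ T* X (C T C)` of the space of bounded operators. By the binomial theorem the `m`-th defect
of `T` is `(Φ - 1) ^ m` applied to the identity. When `T` commutes with `C T C`, the endomorphism
`Φ` commutes with `X ↦ T* X T`, so `T` is `n`-quasi-`(m, C)`-isometric exactly when `(Φ - 1) ^ m`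
annihilates `T*ⁿ Tⁿ` (`isQuasiCIsometric_iff`).

The assignment `(X, Y) ↦ X ⊗ Y` is bilinear, multiplicative and compatible with adjoints and with
conjugations, so it intertwines the pair of endomorphisms attached to `T` and `S` with the one
attached to `T ⊗ S`. The identity
`(Φ - 1) (X ⊗ Y) = (Φ₁ - 1) X ⊗ Φ₂ Y + X ⊗ (Φ₂ - 1) Y` then shows that if `Φ₁ - 1` kills `X` in
`m` steps and `Φ₂ - 1` kills `Y` in `k` steps, then `Φ - 1` kills `X ⊗ Y` in `m + k - 1` steps
(`LinearMap.sub_one_pow_apply_eq_zero_of_intertwines`). It is applied to `X = T*ᴺ Tᴺ` and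
`Y = S*ᴺ Sᴺ` with `N = max n₁ n₂`.
-/

open scoped TensorProduct

section Algebra

variable {R V W U : Type*} [CommRing R] [AddCommGroup V] [AddCommGroup W] [AddCommGroup U]
  [Module R V] [Module R W] [Module R U]

/-- If `β` intertwines `(f, g)` with `Φ`, and `f`, `g` are unipotent of orders `m`, `k` at `x`, `y`,
then `Φ` is unipotent of order `m + k - 1` at `β x y`. With truncated subtraction this also holds
for `m = 0` or `k = 0`, since then `x = 0` or `y = 0`. -/
theorem LinearMap.sub_one_pow_apply_eq_zero_of_intertwines (β : V →ₗ[R] W →ₗ[R] U)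
    {f : Module.End R V} {g : Module.End R W} {Φ : Module.End R U}
    (hβ : ∀ x y, Φ (β x y) = β (f x) (g y)) (m k : ℕ) (x : V) (y : W)
    (hx : ((f - 1) ^ m) x = 0) (hy : ((g - 1) ^ k) y = 0) :
    ((Φ - 1) ^ (m + k - 1)) (β x y) = 0 := by
  induction hs : m + k generalizing m k x y with
  | zero =>
    obtain rfl : m = 0 := by omega
    have hx0 : x = 0 := by simpa using hx
    simp [hx0]
  | succ s ih =>
    rcases m with _ | m
    · have hx0 : x = 0 := by simpa using hx
      simp [hx0]
    rcases k with _ | k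
    · have hy0 : y = 0 := by simpa using hy
      simp [hy0]
    have hstep : (Φ - 1) (β x y) = β ((f - 1) x) (g y) + β x ((g - 1) y) := by
      simp [hβ]
    have hgy : ((g - 1) ^ (k + 1)) (g y) = 0 := by
      have hcomm : Commute ((g - 1) ^ (k + 1)) g :=
        ((Commute.refl g).sub_left (Commute.one_left g)).pow_left _
      rw [← Module.End.mul_apply, hcomm.eq, Module.End.mul_apply, hy, map_zero]
    have h₁ := ih m (k + 1) ((f - 1) x) (g y)
      (by rw [← Module.End.mul_apply, ← pow_succ, hx]) hgy (by omega)
    have h₂ := ih (m + 1) k x ((g - 1) y) hx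
      (by rw [← Module.End.mul_apply, ← pow_succ, hy]) (by omega)
    obtain ⟨r, rfl⟩ : ∃ r, s = r + 1 := ⟨m + k, by omega⟩
    rw [Nat.add_sub_cancel] at h₁ h₂ ⊢
    rw [pow_succ, Module.End.mul_apply, hstep, map_add, h₁, h₂, add_zero]

variable {A : Type*} [Ring A] [Algebra R A]

theorem LinearMap.mulLeftRight_pow_apply (a b x : A) (i : ℕ) :
    ((LinearMap.mulLeftRight R (a, b)) ^ i) x = a ^ i * x * b ^ i := by
  induction i with
  | zero => simp
  | succ i ih =>
    rw [pow_succ', Module.End.mul_apply, ih, LinearMap.mulLeftRight_apply, pow_succ' a, pow_succ b]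
    simp only [mul_assoc]

theorem LinearMap.mulLeftRight_sub_one_pow_apply (a b x : A) (m : ℕ) :
    ((LinearMap.mulLeftRight R (a, b) - 1) ^ m) x =
      ∑ j ∈ Finset.range (m + 1),
        ((-1 : R) ^ j * (m.choose j : R)) • (a ^ (m - j) * x * b ^ (m - j)) := by
  have hcomm : Commute (-1 : Module.End R A) (LinearMap.mulLeftRight R (a, b)) := by
    exact LinearMap.ext fun z => by simp
  rw [sub_eq_neg_add, hcomm.add_pow, LinearMap.sum_apply]
  refine Finset.sum_congr rfl fun j _ => ?_
  have hcoeff : ((-1 : Module.End R A) ^ j * LinearMap.mulLeftRight R (a, b) ^ (m - j)) *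
      (m.choose j : Module.End R A) =
      ((-1 : R) ^ j * (m.choose j : R)) • LinearMap.mulLeftRight R (a, b) ^ (m - j) := by
    rw [← Nat.cast_comm, Algebra.smul_def, ← mul_assoc, map_mul, map_pow, map_neg, map_one,
      map_natCast, Nat.cast_comm]
  rw [hcoeff, LinearMap.smul_apply, LinearMap.mulLeftRight_pow_apply]

end Algebra

section QuasiCIsometric

variable {H : Type*} [NormedAddCommGroup H] [InnerProductSpace ℂ H]

theorem Conjugation.sandwich_pow (C : Conjugation H) (T : H →L[ℂ] H) (i : ℕ) :
    C.sandwich (T ^ i) = C.sandwich T ^ i := by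
  induction i with
  | zero => ext x; simp [Conjugation.sandwich_apply, C.involutive]
  | succ i ih =>
    rw [pow_succ, pow_succ, ← ih]
    ext x
    simp [Conjugation.sandwich_apply, C.involutive]

variable [CompleteSpace H]

theorem isQuasiCIsometric_iff {n m : ℕ} {C : Conjugation H} {T : H →L[ℂ] H}
    (hTC : Commute T (C.sandwich T)) :
    IsQuasiCIsometric n m C T ↔
      ((LinearMap.mulLeftRight ℂ (ContinuousLinearMap.adjoint T, C.sandwich T) - 1) ^ m)
        (ContinuousLinearMap.adjoint T ^ n * T ^ n) = 0 := by
  rw [IsQuasiCIsometric, cIsometryDefect, LinearMap.mulLeftRight_sub_one_pow_apply,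
    Finset.mul_sum, Finset.sum_mul]
  refine iff_of_eq (congrArg (· = 0) (Finset.sum_congr rfl fun j _ => ?_))
  rw [Algebra.mul_smul_comm, Algebra.smul_mul_assoc, Conjugation.sandwich_pow]
  congr 1
  -- Both sides equal `T* ^ (n + (m - j)) * T ^ n * (C T C) ^ (m - j)`.
  rw [← mul_assoc, ← mul_assoc, ← pow_add, ← pow_add, mul_assoc, mul_assoc, add_comm,
    (hTC.pow_pow n (m - j)).eq]

theorem IsQuasiCIsometric.mono_left {n N m : ℕ} {C : Conjugation H} {T : H →L[ℂ] H}
    (h : IsQuasiCIsometric n m C T) (hn : n ≤ N) : IsQuasiCIsometric N m C T := by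
  obtain ⟨r, rfl⟩ := Nat.exists_eq_add_of_le hn
  rw [IsQuasiCIsometric] at h ⊢
  calc _ = ContinuousLinearMap.adjoint T ^ r *
        (ContinuousLinearMap.adjoint T ^ n * cIsometryDefect m C T * T ^ n) * T ^ r := by
        rw [pow_add T, add_comm n r, pow_add]
        simp only [mul_assoc]
    _ = 0 := by rw [h, mul_zero, zero_mul]

end QuasiCIsometric

namespace HilbertTensor

variable {H K : Type*} [NormedAddCommGroup H] [InnerProductSpace ℂ H]
  [NormedAddCommGroup K] [InnerProductSpace ℂ K]

/-- Bounded (conjugate-)linear maps on the Hilbert tensor product that agree on elementary tensors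
are equal. -/
theorem clm_ext {σ : ℂ →+* ℂ} {E : Type*} [NormedAddCommGroup E] [NormedSpace ℂ E]
    {f g : HilbertTensor H K →SL[σ] E}
    (h : ∀ (x : H) (y : K), f ((x ⊗ₜ[ℂ] y : H ⊗[ℂ] K) : HilbertTensor H K) =
      g ((x ⊗ₜ[ℂ] y : H ⊗[ℂ] K) : HilbertTensor H K)) : f = g := by
  ext z
  induction z using UniformSpace.Completion.induction_on with
  | hp => exact isClosed_eq f.continuous g.continuous
  | ih a =>
    induction a using TensorProduct.induction_on with
    | zero => rw [UniformSpace.Completion.coe_zero, map_zero, map_zero]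
    | tmul x y => exact h x y
    | add a b ha hb => rw [UniformSpace.Completion.coe_add, map_add, map_add, ha, hb]

theorem map_mul (T T' : H →L[ℂ] H) (S S' : K →L[ℂ] K) :
    map (T * T') (S * S') = map T S * map T' S' :=
  clm_ext fun x y => by simp only [mul_apply_eq_comp, map_tmul]

theorem map_one_one : map (1 : H →L[ℂ] H) (1 : K →L[ℂ] K) = 1 :=
  clm_ext fun x y => by simp only [map_tmul, one_apply_eq_self]

theorem map_pow (T : H →L[ℂ] H) (S : K →L[ℂ] K) (i : ℕ) :
    map (T ^ i) (S ^ i) = map T S ^ i := by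
  induction i with
  | zero => simp only [pow_zero, map_one_one]
  | succ i ih => rw [pow_succ, pow_succ, pow_succ, map_mul, ih]

/-- The map `(T, S) ↦ T ⊗ S` as a bilinear map. -/
noncomputable def mapBilinear : (H →L[ℂ] H) →ₗ[ℂ] (K →L[ℂ] K) →ₗ[ℂ]
    (HilbertTensor H K →L[ℂ] HilbertTensor H K) :=
  LinearMap.mk₂ ℂ map
    (fun T T' S => clm_ext fun x y => by
      simp only [add_apply, map_tmul, TensorProduct.add_tmul,
        UniformSpace.Completion.coe_add])
    (fun c T S => clm_ext fun x y => by
      simp only [smul_apply, map_tmul, ← TensorProduct.smul_tmul',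
        UniformSpace.Completion.coe_smul])
    (fun T S S' => clm_ext fun x y => by
      simp only [add_apply, map_tmul, TensorProduct.tmul_add,
        UniformSpace.Completion.coe_add])
    (fun c T S => clm_ext fun x y => by
      simp only [smul_apply, map_tmul, TensorProduct.tmul_smul,
        UniformSpace.Completion.coe_smul])

theorem mapBilinear_apply (T : H →L[ℂ] H) (S : K →L[ℂ] K) : mapBilinear T S = map T S := rfl

theorem sandwich_map (C : Conjugation H) (D : Conjugation K) (T : H →L[ℂ] H) (S : K →L[ℂ] K) :
    (C.tensor D).sandwich (map T S) = map (C.sandwich T) (D.sandwich S) :=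
  clm_ext fun x y => by
    simp only [Conjugation.sandwich_apply, Conjugation.tensor_tmul, map_tmul]

theorem adjoint_map [CompleteSpace H] [CompleteSpace K] (T : H →L[ℂ] H) (S : K →L[ℂ] K) :
    ContinuousLinearMap.adjoint (map T S) =
      map (ContinuousLinearMap.adjoint T) (ContinuousLinearMap.adjoint S) := by
  refine clm_ext fun x y => ext_inner_right ℂ fun z => ?_
  rw [ContinuousLinearMap.adjoint_inner_left]
  -- For fixed `x ⊗ y` both sides are bounded linear functionals of `z`.
  refine DFunLike.congr_fun
    (clm_ext (f := (innerSL ℂ ((x ⊗ₜ[ℂ] y : H ⊗[ℂ] K) : HilbertTensor H K)).comp (map T S))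
      (g := innerSL ℂ (map (ContinuousLinearMap.adjoint T) (ContinuousLinearMap.adjoint S)
        ((x ⊗ₜ[ℂ] y : H ⊗[ℂ] K) : HilbertTensor H K))) fun u v => ?_) z
  simp only [ContinuousLinearMap.comp_apply, innerSL_apply_apply, map_tmul,
    UniformSpace.Completion.inner_coe, TensorProduct.inner_tmul,
    ContinuousLinearMap.adjoint_inner_left]

end HilbertTensor

theorem theorem2p6 {H : Type*} [NormedAddCommGroup H] [InnerProductSpace ℂ H] [CompleteSpace H]
    (n₁ n₂ m k : ℕ) (hm : 1 ≤ m) (hk : 1 ≤ k)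
    (C D : Conjugation H) (T S : H →L[ℂ] H)
    (hT : IsQuasiCIsometric n₁ m C T) (hS : IsQuasiCIsometric n₂ k D S)
    (hTC : T * C.sandwich T = C.sandwich T * T) (hSD : S * D.sandwich S = D.sandwich S * S) :
    IsQuasiCIsometric (max n₁ n₂) (m + k - 1) (C.tensor D) (HilbertTensor.map T S) := by
  have hcomm : Commute (HilbertTensor.map T S) ((C.tensor D).sandwich (HilbertTensor.map T S)) := by
    rw [HilbertTensor.sandwich_map, Commute, SemiconjBy, ← HilbertTensor.map_mul, hTC, hSD,
      HilbertTensor.map_mul]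
  have hT' := (isQuasiCIsometric_iff hTC).1 (hT.mono_left (le_max_left n₁ n₂))
  have hS' := (isQuasiCIsometric_iff hSD).1 (hS.mono_left (le_max_right n₁ n₂))
  rw [isQuasiCIsometric_iff hcomm, HilbertTensor.adjoint_map, HilbertTensor.sandwich_map,
    ← HilbertTensor.map_pow, ← HilbertTensor.map_pow, ← HilbertTensor.map_mul,
    ← HilbertTensor.mapBilinear_apply (_ * _)]
  refine LinearMap.sub_one_pow_apply_eq_zero_of_intertwines _ (fun X Y => ?_) m k _ _ hT' hS'
  simp only [LinearMap.mulLeftRight_apply, HilbertTensor.mapBilinear_apply, HilbertTensor.map_mul]
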